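/- Let $n\ge 0$ and $d>n$ be integers. A binary form is a homogeneous polynomial in $\mathbb C[s,t]$. Let $C,D\subset\mathbb P^n=\mathbb P^n_{\mathbb C}$ be non-degenerate rational curves of degree $d$. That is, neither curve lies in a hyperplane, and $C=\mathbf p(\mathbb P^1)$, $D=\mathbf q(\mathbb P^1)$ for morphisms $\mathbf p=[p_0:\dots:p_n]$, $\mathbf q=[q_0:\dots:q_n]$ from $\mathbb P^1$ to $\mathbb P^n$ with the following properties: the $p_i$ are binary forms of degree $d$ without a common factor, so are the $q_i$, and $\mathbf p$ and $\mathbf q$ are birational onto their images, i.e. injective outside a finite subset of $\mathbb P^1$. Let $$\Delta_{\mathbf p}(s,t)=\det\left[\frac{\partial^n\mathbf p}{\partial s^n},\ \frac{\partial^n\mathbf p}{\partial s^{n-1}\partial t},\ \dots,\ \frac{\partial^n\mathbf p}{\partial t^n}\right]$$ be the stall (osculation) form of $\mathbf p$, and let $\Delta_{\mathbf q}$ be that of $\mathbf q$. Put $$\mathrm{Aut}(\mathbb P^n)_{C,D}=\{\phi\in \mathrm{PGL}_{n+1}(\mathbb C):\ \phi(C)=D\},\qquad \mathrm{Aut}(\mathbb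 P^1)_{\Delta_{\mathbf p},\Delta_{\mathbf q}}=\{\psi\in \mathrm{PGL}_2(\mathbb C):\ \exists\,\lambda\in\mathbb C^*,\ \Delta_{\mathbf q}\circ\psi=\lambda\,\Delta_{\mathbf p}\},$$ where $\Delta_{\mathbf q}\circ\psi$ is formed with some matrix representing $\psi$. Then $\mathrm{Aut}(\mathbb P^1)_{\Delta_{\mathbf p},\Delta_{\mathbf q}}$ is a candidate set for $\mathrm{Aut}(\mathbb P^n)_{C,D}$, with inclusion $\phi\mapsto\mathbf q^{-1}\circ\phi\circ\mathbf p$. That is, there is an injective map $$\iota:\mathrm{Aut}(\mathbb P^n)_{C,D}\hookrightarrow \mathrm{Aut}(\mathbb P^1)_{\Delta_{\mathbf p},\Delta_{\mathbf q}}$$ such that, for every $\phi\in\mathrm{Aut}(\mathbb P^n)_{C,D}$, the automorphism $\iota(\phi)$ is the rational map $\mathbf q^{-1}\circ\phi\circ\mathbf p$ (for all but finitely many $x\in\mathbb P^1$, the point $\iota(\phi)(x)$ is the unique preimage of $\phi(\mathbf p(x))$ under $\mathbf q$), and $\mathbf q\circ\iota(\phi)=\phi\circ\mathbf p$ on all of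 $\mathbb P^1$. -/

import Mathlib

open scoped LinearAlgebra.Projectivization MatrixGroups

noncomputable section

namespace RatCurve

open MvPolynomial

/-- The complex projective space `ℙⁿ`, i.e. the set of lines through the origin of `ℂⁿ⁺¹`. Its
automorphism group (the group of projective transformations) is `PGL(n + 1, ℂ)`, with its Mathlib
action on `ℙ ℂ (Fin (n + 1) → ℂ)`. -/
abbrev PSpace (n : ℕ) : Type := ℙ ℂ (Fin (n + 1) → ℂ)

/-- Binary forms live in `ℂ[s, t]`, with `s = X 0` and `t = X 1`. -/
abbrev BinPoly : Type := MvPolynomial (Fin 2) ℂ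

/-- A morphism `ℙ¹ → ℙⁿ` of degree `d`: a tuple `[p₀(s,t) : ⋯ : pₙ(s,t)]` of binary forms of
degree `d` without a common factor. -/
structure Param (n d : ℕ) where
  form : Fin (n + 1) → BinPoly
  isHomogeneous : ∀ i, (form i).IsHomogeneous d
  noCommonFactor : ∀ r : BinPoly, (∀ i, r ∣ form i) → IsUnit r

/-- Homogeneity for evaluation in a `ℂ`-algebra. -/
theorem aeval_smul_of_isHomogeneous {A : Type*} [CommRing A] [Algebra ℂ A] {F : BinPoly} {d : ℕ}
    (hF : F.IsHomogeneous d) (c : A) (v : Fin 2 → ℂ) :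
    aeval (fun j => v j • c) F = eval v F • c ^ d := by
  rw [aeval_def, eval₂_eq', eval_eq', Finset.sum_smul]
  refine Finset.sum_congr rfl fun m hm => ?_
  have hd : m 0 + m 1 = d := by
    have := hF (mem_support_iff.mp hm)
    rw [Finsupp.weight_apply, Finsupp.sum_fintype _ _ (by simp)] at this
    simpa [Fin.sum_univ_two] using this
  simp only [Fin.prod_univ_two, ← hd, pow_add, Algebra.smul_def, map_mul, map_pow]
  ring

/-- A binary form vanishing at `v ≠ 0` is divisible by the linear form `v₁ s - v₀ t`. -/
theorem linear_dvd_of_eval_eq_zero {F : BinPoly} {d : ℕ} (hF : F.IsHomogeneous d)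
    {v : Fin 2 → ℂ} (hv : v ≠ 0) (h : eval v F = 0) :
    (C (v 1) * X 0 - C (v 0) * X 1 : BinPoly) ∣ F := by
  set l : BinPoly := C (v 1) * X 0 - C (v 0) * X 1 with hl
  rw [← Ideal.mem_span_singleton, ← Ideal.Quotient.eq_zero_iff_mem]
  let π : BinPoly →ₐ[ℂ] BinPoly ⧸ Ideal.span {l} := Ideal.Quotient.mkₐ ℂ _
  change π F = 0
  have hrel : v 1 • π (X 0) = v 0 • π (X 1) := by
    rw [← sub_eq_zero, ← map_smul, ← map_smul, ← map_sub, smul_eq_C_mul, smul_eq_C_mul]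
    exact Ideal.Quotient.eq_zero_iff_mem.mpr (Ideal.mem_span_singleton_self l)
  have hc : ∃ c, ∀ j, π (X j) = v j • c := by
    by_cases h0 : v 0 = 0
    · have h1 : v 1 ≠ 0 := fun h1 => hv (funext fun j => by fin_cases j <;> simp [h0, h1])
      refine ⟨(v 1)⁻¹ • π (X 1), fun j => ?_⟩
      fin_cases j
      · have : π (X 0) = 0 := by
          rw [h0, zero_smul] at hrel
          exact (smul_eq_zero.mp hrel).resolve_left h1
        simp [h0, this]
      · simp [smul_smul, h1]
    · refine ⟨(v 0)⁻¹ • π (X 0), fun j => ?_⟩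
      fin_cases j
      · simp [smul_smul, h0]
      · simp only [Fin.mk_one]
        rw [smul_comm, hrel, smul_smul, inv_mul_cancel₀ h0, one_smul]
  obtain ⟨c, hc⟩ := hc
  have : π F = aeval (fun j => π (X j)) F := by
    exact DFunLike.congr_fun (aeval_unique π) F
  rw [this, funext hc, aeval_smul_of_isHomogeneous hF, h, zero_smul]

namespace Param

variable {n d : ℕ}

/-- The value of the tuple of forms at a vector of `ℂ²`. -/
def evalAt (p : Param n d) (v : Fin 2 → ℂ) : Fin (n + 1) → ℂ := fun i => eval v (p.form i)

theorem evalAt_ne_zero (p : Param n d) {v : Fin 2 → ℂ} (hv : v ≠ 0) : p.evalAt v ≠ 0 := by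
  intro h
  have hu := p.noCommonFactor _ fun i =>
    linear_dvd_of_eval_eq_zero (p.isHomogeneous i) hv (congrFun h i)
  have := hu.map (eval v)
  simp [mul_comm] at this

theorem evalAt_smul (p : Param n d) (a : ℂ) (v : Fin 2 → ℂ) :
    p.evalAt (a • v) = a ^ d • p.evalAt v := by
  funext i
  have := aeval_smul_of_isHomogeneous (p.isHomogeneous i) a v
  simp only [evalAt, Pi.smul_apply, smul_eq_mul] at this ⊢
  rw [mul_comm, ← this]
  congr 2
  funext j
  simp [mul_comm]

/-- The morphism `ℙ¹ → ℙⁿ`, `[s : t] ↦ [p₀(s,t) : ⋯ : pₙ(s,t)]`. -/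
def toMap (p : Param n d) : PSpace 1 → PSpace n :=
  Projectivization.lift
    (fun v : {v : Fin 2 → ℂ // v ≠ 0} =>
      Projectivization.mk ℂ (p.evalAt v) (p.evalAt_ne_zero v.2))
    (by
      rintro ⟨v, hv⟩ ⟨w, hw⟩ a (rfl : v = a • w)
      rw [Projectivization.mk_eq_mk_iff']
      exact ⟨a ^ d, (p.evalAt_smul a w).symm⟩)

theorem toMap_mk (p : Param n d) {v : Fin 2 → ℂ} (hv : v ≠ 0) :
    p.toMap (Projectivization.mk ℂ v hv) =
      Projectivization.mk ℂ (p.evalAt v) (p.evalAt_ne_zero hv) := rfl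

/-- Birationality onto the image: the morphism is almost everywhere injective, i.e. injective
outside a finite subset of `ℙ¹`. -/
def IsBirational (p : Param n d) : Prop :=
  ∃ S : Set (PSpace 1), S.Finite ∧ Set.InjOn p.toMap Sᶜ

/-- The osculation (stall) form
`Δ_p = det [∂ⁿp/∂sⁿ, ∂ⁿp/∂sⁿ⁻¹∂t, …, ∂ⁿp/∂tⁿ]`; the column with index `k` is `∂ⁿp/∂sⁿ⁻ᵏ∂tᵏ`. -/
def stallForm (p : Param n d) : BinPoly :=
  Matrix.det (Matrix.of fun i k : Fin (n + 1) =>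
    (pderiv 0)^[n - (k : ℕ)] ((pderiv 1)^[(k : ℕ)] (p.form i)))

end Param

/-- `C` is the rational curve of degree `d` in `ℙⁿ` parametrized by the birational
morphism `p`. -/
structure IsRationalCurve {n d : ℕ} (C : Set (PSpace n)) (p : Param n d) : Prop where
  isBirational : p.IsBirational
  range_eq : Set.range p.toMap = C

/-- The hyperplane `a₀ x₀ + ⋯ + aₙ xₙ = 0`. -/
def hyperplane {n : ℕ} (a : Fin (n + 1) → ℂ) : Set (PSpace n) :=
  {x | ∑ i, a i * x.rep i = 0}

/-- A subset of `ℙⁿ` is non-degenerate if no hyperplane contains it. -/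
def Nondegenerate {n : ℕ} (C : Set (PSpace n)) : Prop :=
  ∀ a : Fin (n + 1) → ℂ, a ≠ 0 → ¬ C ⊆ hyperplane a

/-- `Aut(ℙⁿ)_{A,B}`: the projective transformations mapping `A` onto `B`. -/
def equivs {n : ℕ} (A B : Set (PSpace n)) : Set PGL(Fin (n + 1), ℂ) :=
  {φ | (fun x => φ • x) '' A = B}

/-- The form `G ∘ M`, i.e. `G(m₀₀ s + m₀₁ t, m₁₀ s + m₁₁ t)`. -/
def substForm (G : BinPoly) (M : GL (Fin 2) ℂ) : BinPoly :=
  bind₁ (fun i => ∑ j, C (M i j) * X j) G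

/-- `Aut(ℙ¹)_{F,G}`: the automorphisms `ψ` of `ℙ¹` such that `G ∘ ψ = lam • F` for some nonzero
complex number `lam`. -/
def formEquivs (F G : BinPoly) : Set PGL(Fin 2, ℂ) :=
  {ψ | ∃ M : GL (Fin 2) ℂ, Matrix.ProjGenLinGroup.mk M = ψ ∧
    ∃ lam : ℂ, lam ≠ 0 ∧ substForm G M = lam • F}

/-- `ψ` is the rational map `q⁻¹ ∘ φ ∘ p`: for all but finitely many `x ∈ ℙ¹`, the point `ψ(x)`
is the one and only preimage under `q` of `φ(p(x))`. -/
def IsInvComp {n d : ℕ} (q : Param n d) (φ : PGL(Fin (n + 1), ℂ)) (p : Param n d)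
    (ψ : PGL(Fin 2, ℂ)) : Prop :=
  ∀ᶠ x : PSpace 1 in Filter.cofinite, q.toMap ⁻¹' {φ • p.toMap x} = {ψ • x}

end RatCurve

end

/-!
Let `φ` map `C` onto `D`. Since `p` and `q` are birational onto their images, over almost every `x`
the correspondence `{(x, y) | φ(p(x)) = q(y)}` has exactly one point, so it is generically the graph
of a rational function `y = N(x) / D(x)` in lowest terms. The tuples `q(N, D)` and `φ ∘ p` are
proportional and neither has a common zero, so they agree up to a constant; comparing degrees shows
that `N` and `D` have degree at most one, i.e. that `y` is given by a linear substitution `M`.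

The stall form is multiplied by a nonzero constant when `p` is composed with an invertible linear
map of the target, and it is also equivariant, up to a constant, under linear substitutions. Hence
the class of `M` maps one stall form to a multiple of the other. This class determines `φ` on `C`,
and therefore `φ` itself, because the coordinate forms of a non-degenerate curve are linearly
independent.
-/

namespace RatCurve

section LinearSubstitution

open MvPolynomial Matrix

variable {R l m n : Type*} [CommSemiring R] [Fintype m] [Fintype n]

/-- The substitution `F ↦ F ∘ M` of linear forms, for a possibly non-square matrix `M`. -/
noncomputable def linSubst (M : Matrix l m R) : MvPolynomial l R →ₐ[R] MvPolynomial m R :=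
  bind₁ M.toMvPolynomial

theorem linSubst_X (M : Matrix l m R) (i : l) : linSubst M (X i) = M.toMvPolynomial i :=
  bind₁_X_right _ _

theorem linSubst_linSubst (A : Matrix m n R) (B : Matrix l m R) (F : MvPolynomial l R) :
    linSubst A (linSubst B F) = linSubst (B * A) F := by
  rw [linSubst, linSubst, linSubst, bind₁_bind₁]
  simp only [← toMvPolynomial_mul]

theorem linSubst_one [DecidableEq m] (F : MvPolynomial m R) :
    linSubst (1 : Matrix m m R) F = F := by
  rw [linSubst, toMvPolynomial_one, bind₁_X_left, AlgHom.id_apply]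

theorem eval_linSubst (M : Matrix l m R) (F : MvPolynomial l R) (v : m → R) :
    eval v (linSubst M F) = eval (M *ᵥ v) F := by
  rw [linSubst, eval, eval₂Hom_bind₁]
  congr 2
  exact funext fun i => toMvPolynomial_eval_eq_apply M i v

theorem isHomogeneous_linSubst (M : Matrix l m R) {F : MvPolynomial l R} {d : ℕ}
    (hF : F.IsHomogeneous d) : (linSubst M F).IsHomogeneous d := by
  have := hF.aeval M.toMvPolynomial M.toMvPolynomial_isHomogeneous
  rwa [one_mul] at this

theorem substForm_eq_linSubst (F : BinPoly) (M : GL (Fin 2) ℂ) :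
    substForm F M = linSubst (M : Matrix (Fin 2) (Fin 2) ℂ) F := by
  simp only [substForm, linSubst, C_mul_X_eq_monomial]
  rfl

end LinearSubstitution

section DirectionalDerivative

open MvPolynomial Matrix

variable {R l m : Type*} [CommSemiring R]

/-- The derivative in the constant direction `v`. -/
noncomputable def dirDeriv (v : m → R) : Derivation R (MvPolynomial m R) (MvPolynomial m R) :=
  mkDerivation R fun i => C (v i)

theorem dirDeriv_X (v : m → R) (i : m) : dirDeriv v (X i) = C (v i) :=
  mkDerivation_X _ _ _

theorem dirDeriv_eq_smul_pderiv_add_smul_pderiv (v : Fin 2 → R) :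
    dirDeriv v = v 0 • pderiv 0 + v 1 • pderiv 1 :=
  derivation_ext fun i => by
    fin_cases i <;> simp [dirDeriv_X, pderiv_X, smul_eq_C_mul]

theorem dirDeriv_toMvPolynomial [Fintype m] (M : Matrix l m R) (v : m → R) (i : l) :
    dirDeriv v (M.toMvPolynomial i) = C ((M *ᵥ v) i) := by
  simp only [toMvPolynomial, ← C_mul_X_eq_monomial, ← smul_eq_C_mul, map_sum, Derivation.map_smul,
    dirDeriv_X, mulVec, dotProduct, map_mul]

theorem dirDeriv_linSubst [Fintype m] (M : Matrix l m R) (v : m → R) (F : MvPolynomial l R) :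
    dirDeriv v (linSubst M F) = linSubst M (dirDeriv (M *ᵥ v) F) := by
  induction F using MvPolynomial.induction_on with
  | C a => simp [linSubst, ← algebraMap_eq]
  | add F G hF hG => simp only [map_add, hF, hG]
  | mul_X F i hF =>
    simp only [map_mul, Derivation.leibniz, hF, linSubst_X, dirDeriv_toMvPolynomial, dirDeriv_X,
      map_add, smul_eq_mul, ← algebraMap_eq, AlgHom.commutes]

theorem iterate_dirDeriv_linSubst [Fintype m] (M : Matrix l m R) (v : m → R) (k : ℕ)
    (F : MvPolynomial l R) :
    (dirDeriv v)^[k] (linSubst M F) = linSubst M ((dirDeriv (M *ᵥ v))^[k] F) :=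
  (Function.Semiconj.iterate_right (fun G => (dirDeriv_linSubst M v G).symm) k F).symm

end DirectionalDerivative

section MixedPartials

open MvPolynomial

variable {R m : Type*} [CommRing R]

theorem commute_pderiv (i j : m) :
    Commute (pderiv i : Derivation R (MvPolynomial m R) _).toLinearMap
      (pderiv j : Derivation R (MvPolynomial m R) _).toLinearMap := by
  classical
  have bracket_eq_zero :
      ⁅(pderiv i : Derivation R (MvPolynomial m R) (MvPolynomial m R)), pderiv j⁆ = 0 :=
    derivation_ext fun k => by
      rw [Derivation.commutator_apply]
      simp [pderiv_X, Pi.single_apply, apply_ite]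
  refine LinearMap.ext fun F => sub_eq_zero.mp ?_
  have := DFunLike.congr_fun bracket_eq_zero F
  rwa [Derivation.commutator_apply] at this

theorem iterate_dirDeriv_eq_sum (v : Fin 2 → R) (n : ℕ) (F : MvPolynomial (Fin 2) R) :
    (dirDeriv v)^[n] F = ∑ k : Fin (n + 1), (n.choose k * (v 1 ^ (k : ℕ) * v 0 ^ (n - k : ℕ))) •
      (pderiv 0)^[n - k] ((pderiv 1)^[k] F) := by
  let D (i : Fin 2) : Module.End R (MvPolynomial (Fin 2) R) := (pderiv i).toLinearMap
  have iterate_eq (i : Fin 2) (k : ℕ) (G : MvPolynomial (Fin 2) R) :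
      (D i ^ k) G = (pderiv i)^[k] G := by rw [Module.End.pow_apply]; rfl
  have dirDeriv_eq : (dirDeriv v).toLinearMap = v 1 • D 1 + v 0 • D 0 := by
    refine LinearMap.ext fun G => ?_
    simp [dirDeriv_eq_smul_pderiv_add_smul_pderiv, D, add_comm]
  have comm : Commute (D 1) (D 0) := commute_pderiv 1 0
  calc (dirDeriv v)^[n] F
    _ = ((dirDeriv v).toLinearMap ^ n) F := by rw [Module.End.pow_apply]; rfl
    _ = _ := by
      rw [dirDeriv_eq, ((comm.smul_left (v 1)).smul_right (v 0)).add_pow, Finset.sum_range,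
        LinearMap.sum_apply]
      refine Finset.sum_congr rfl fun k _ => ?_
      rw [smul_pow, smul_pow, smul_mul_smul_comm, (comm.pow_pow _ _).eq, ← nsmul_eq_mul',
        LinearMap.smul_apply, LinearMap.smul_apply, Module.End.mul_apply, iterate_eq, iterate_eq,
        ← Nat.cast_smul_eq_nsmul R, smul_smul]

end MixedPartials

section Osculation

open MvPolynomial Matrix

variable {R : Type*} [CommRing R] {n : ℕ}

/-- The matrix of partial derivatives of order `n` of a tuple of `n + 1` binary forms, whose
determinant is the stall form of the tuple; the column with index `k` is `∂ⁿ/∂sⁿ⁻ᵏ∂tᵏ`. -/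
noncomputable def oscMatrix (f : Fin (n + 1) → MvPolynomial (Fin 2) R) :
    Matrix (Fin (n + 1)) (Fin (n + 1)) (MvPolynomial (Fin 2) R) :=
  of fun i k => (pderiv 0)^[n - k] ((pderiv 1)^[k] (f i))

theorem oscMatrix_linearCombination (A : Matrix (Fin (n + 1)) (Fin (n + 1)) R)
    (f : Fin (n + 1) → MvPolynomial (Fin 2) R) :
    oscMatrix (fun i => ∑ j, A i j • f j) = A.map C * oscMatrix f := by
  ext1 i k
  simp only [oscMatrix, of_apply, mul_apply, map_apply, ← smul_eq_C_mul,
    ← Derivation.coeFn_coe, ← Module.End.pow_apply, map_sum, map_smul]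

theorem det_oscMatrix_linearCombination (A : Matrix (Fin (n + 1)) (Fin (n + 1)) R)
    (f : Fin (n + 1) → MvPolynomial (Fin 2) R) :
    (oscMatrix fun i => ∑ j, A i j • f j).det = A.det • (oscMatrix f).det := by
  rw [oscMatrix_linearCombination, det_mul, smul_eq_C_mul, RingHom.map_det, RingHom.mapMatrix_apply]

theorem det_iterate_dirDeriv (v : Fin (n + 1) → Fin 2 → R)
    (f : Fin (n + 1) → MvPolynomial (Fin 2) R) :
    (of fun i k => (dirDeriv (v k))^[n] (f i)).det =
      ((∏ k : Fin (n + 1), (n.choose k : R)) * (projVandermonde (v · 1) (v · 0)).det) •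
        (oscMatrix f).det := by
  have factorization : (of fun i k => (dirDeriv (v k))^[n] (f i)) = oscMatrix f *
      (diagonal (fun k : Fin (n + 1) => (n.choose k : R)) *
        (projVandermonde (v · 1) (v · 0))ᵀ).map C := by
    ext1 i k
    rw [of_apply, iterate_dirDeriv_eq_sum, mul_apply]
    refine Finset.sum_congr rfl fun j _ => ?_
    rw [map_apply, diagonal_mul, transpose_apply, projVandermonde_apply, Fin.val_rev,
      Nat.add_sub_add_right, smul_eq_C_mul, mul_comm, oscMatrix, of_apply]
  rw [factorization, det_mul, ← RingHom.mapMatrix_apply, ← RingHom.map_det, det_mul, det_diagonal,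
    det_transpose, mul_comm, smul_eq_C_mul]

theorem det_projVandermonde_mulVec {N : ℕ} (M : Matrix (Fin 2) (Fin 2) R) (v : Fin N → Fin 2 → R) :
    (projVandermonde (fun k => (M *ᵥ v k) 1) (fun k => (M *ᵥ v k) 0)).det =
      M.det ^ N.choose 2 * (projVandermonde (v · 1) (v · 0)).det := by
  have cross_mulVec (i j : Fin N) :
      (M *ᵥ v j) 1 * (M *ᵥ v i) 0 - (M *ᵥ v i) 1 * (M *ᵥ v j) 0 =
        M.det * (v j 1 * v i 0 - v i 1 * v j 0) := by
    simp only [mulVec, dotProduct, Fin.sum_univ_two, det_fin_two]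
    ring
  have card_pairs : ∑ i : Fin N, (Finset.Ioi i).card = N.choose 2 := by
    simp only [Fin.card_Ioi]
    rw [Fin.sum_univ_eq_sum_range (fun i => N - 1 - i), Finset.sum_range_reflect (fun i => i),
      Finset.sum_range_id, Nat.choose_two_right]
  simp only [det_projVandermonde, cross_mulVec, Finset.prod_mul_distrib, Finset.prod_const,
    Finset.prod_pow_eq_pow_sum, card_pairs]

/- Both sides are compared after multiplication by a Vandermonde determinant: derivatives of order
`n` in `n + 1` fixed directions, unlike partial derivatives, transform by substitution alone. -/
theorem det_oscMatrix_linSubst [IsDomain R] [CharZero R] (M : Matrix (Fin 2) (Fin 2) R)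
    (f : Fin (n + 1) → MvPolynomial (Fin 2) R) :
    (oscMatrix fun i => linSubst M (f i)).det =
      M.det ^ (n + 1).choose 2 • linSubst M (oscMatrix f).det := by
  let v (k : Fin (n + 1)) : Fin 2 → R := ![1, (k : ℕ)]
  set c := (∏ k : Fin (n + 1), (n.choose k : R)) * (projVandermonde (v · 1) (v · 0)).det with hc
  have c_ne_zero : c ≠ 0 := by
    refine mul_ne_zero (Finset.prod_ne_zero_iff.mpr fun k _ => ?_) ?_
    · exact_mod_cast (Nat.choose_pos (Nat.lt_succ_iff.mp k.2)).ne'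
    · change (projVandermonde (fun k : Fin (n + 1) => ((k : ℕ) : R)) 1).det ≠ 0
      rw [← vandermonde_eq_projVandermonde, det_vandermonde_ne_zero_iff]
      exact Nat.cast_injective.comp Fin.val_injective
  refine smul_right_injective _ c_ne_zero ?_
  calc c • (oscMatrix fun i => linSubst M (f i)).det
    _ = (of fun i k => (dirDeriv (v k))^[n] (linSubst M (f i))).det :=
      (det_iterate_dirDeriv v _).symm
    _ = linSubst M (of fun i k => (dirDeriv (M *ᵥ v k))^[n] (f i)).det := by
      simp only [iterate_dirDeriv_linSubst, AlgHom.map_det]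
      rfl
    _ = c • M.det ^ (n + 1).choose 2 • linSubst M (oscMatrix f).det := by
      rw [det_iterate_dirDeriv, det_projVandermonde_mulVec, map_smul, smul_smul, hc]
      ring_nf

end Osculation

section RationalSections

open Polynomial Filter

open scoped Polynomial.Bivariate

theorem exists_mem_forall_dvd_leadingCoeff_pow_mul {R : Type*} [CommRing R] {I : Ideal R[X]}
    (hI : I ≠ ⊥) :
    ∃ G ∈ I, G ≠ 0 ∧ ∀ F ∈ I, ∃ k : ℕ, G ∣ C (G.leadingCoeff ^ k) * F := by
  obtain ⟨G, ⟨hG, hG₀⟩, G_minimal⟩ := exists_minimalFor_of_wellFoundedLT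
    (fun G => G ∈ I ∧ G ≠ 0) natDegree (Submodule.exists_mem_ne_zero_of_ne_bot hI)
  have natDegree_le {F : R[X]} (hF : F ∈ I) (hF₀ : F ≠ 0) : G.natDegree ≤ F.natDegree :=
    (le_total _ _).elim id (G_minimal ⟨hF, hF₀⟩)
  refine ⟨G, hG, hG₀, fun F => ?_⟩
  -- Pseudo-division of `F` by `G`, by induction on the degree of `F`.
  induction hm : F.natDegree using Nat.strong_induction_on generalizing F with
  | _ m ih =>
  subst hm
  intro hF
  rcases eq_or_ne F 0 with rfl | hF₀
  · exact ⟨0, by simp⟩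
  have hle := natDegree_le hF hF₀
  rcases F.natDegree.eq_zero_or_pos with hF_deg | hF_deg
  · have G_natDegree : G.natDegree = 0 := Nat.le_zero.mp (hF_deg ▸ hle)
    refine ⟨1, ?_⟩
    rw [pow_one, leadingCoeff, G_natDegree, ← eq_C_of_natDegree_eq_zero G_natDegree]
    exact dvd_mul_right G F
  · have cancel_mem : G.cancelLeads F ∈ I :=
      I.sub_mem (I.mul_mem_left _ hF) (I.mul_mem_left _ hG)
    obtain ⟨k, hk⟩ := ih _ (natDegree_cancelLeads_lt_of_natDegree_le_natDegree hle hF_deg) _ rfl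
      cancel_mem
    refine ⟨k + 1, ?_⟩
    rw [cancelLeads, Nat.sub_eq_zero_of_le hle, pow_zero, mul_one, mul_sub, ← mul_assoc, ← C_mul,
      ← pow_succ] at hk
    exact (dvd_sub_left (Dvd.intro_left _ (mul_assoc _ _ _))).mp hk

theorem eventually_eval_ne_zero {R : Type*} [CommRing R] [IsDomain R] {D : R[X]} (hD : D ≠ 0) :
    ∀ᶠ x in cofinite, D.eval x ≠ 0 := by
  simpa only [ne_eq, eventually_cofinite, not_not, IsRoot.def] using finite_setOfPred_isRoot hD

theorem eq_of_eventually_eval_eq {R : Type*} [CommRing R] [IsDomain R] [Infinite R] {F G : R[X]}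
    (h : ∀ᶠ x in cofinite, F.eval x = G.eval x) : F = G :=
  eq_of_infinite_eval_eq F G (frequently_cofinite_iff_infinite.mp h.frequently)

variable {K : Type*} [Field K]

theorem exists_isCoprime_eventually_div_eq (N : K[X]) {D : K[X]} (hD : D ≠ 0) :
    ∃ N' D' : K[X], IsCoprime N' D' ∧
      ∀ᶠ x in cofinite, D'.eval x ≠ 0 ∧ N'.eval x / D'.eval x = N.eval x / D.eval x := by
  classical
  let _ := IsBezout.toGCDDomain K[X]
  obtain ⟨N', D', hN, hD', gcd_isUnit⟩ := extract_gcd N D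
  refine ⟨N', D', (gcd_isUnit_iff N' D').mp gcd_isUnit, ?_⟩
  filter_upwards [eventually_eval_ne_zero hD] with x hx
  rw [hD', eval_mul] at hx
  refine ⟨right_ne_zero_of_mul hx, ?_⟩
  rw [congrArg (eval x) hN, congrArg (eval x) hD', eval_mul, eval_mul,
    mul_div_mul_left _ _ (left_ne_zero_of_mul hx)]

variable [IsAlgClosed K]

theorem nextCoeff_eq_of_unique_root {g : K[X]} {y : K} (h : ∀ z, g.eval z = 0 ↔ z = y) :
    g.natDegree ≠ 0 ∧ g.nextCoeff = -(g.natDegree * y) * g.leadingCoeff := by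
  have hg : g ≠ 0 := by
    rintro rfl
    simpa using ((h (y + 1)).mp eval_zero)
  have splits := IsAlgClosed.splits g
  have roots_eq : g.roots = Multiset.replicate g.natDegree y :=
    Multiset.eq_replicate.mpr ⟨splits.natDegree_eq_card_roots.symm,
      fun z hz => (h z).mp (isRoot_of_mem_roots hz)⟩
  constructor
  · rw [splits.natDegree_eq_card_roots]
    exact (Multiset.card_pos_iff_exists_mem.mpr ⟨y, (mem_roots hg).mpr ((h y).mpr rfl)⟩).ne'
  · rw [splits.nextCoeff_eq_neg_sum_roots_mul_leadingCoeff, roots_eq, Multiset.sum_replicate,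
      nsmul_eq_mul]
    ring

theorem eq_div_of_unique_root_evalEval [CharZero K] {G : K[X][Y]} {x y : K}
    (hx : G.leadingCoeff.eval x ≠ 0) (h : ∀ z, G.evalEval x z = 0 ↔ z = y) :
    G.natDegree ≠ 0 ∧
      y = (-G.nextCoeff).eval x / (C (G.natDegree : K) * G.leadingCoeff).eval x := by
  simp only [← map_evalRingHom_eval] at h
  obtain ⟨natDegree_ne_zero, nextCoeff_eq⟩ := nextCoeff_eq_of_unique_root h
  rw [leadingCoeff_map_of_leadingCoeff_ne_zero _ hx, nextCoeff_map_of_leadingCoeff_ne_zero _ hx,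
    natDegree_map_of_leadingCoeff_ne_zero _ hx, coe_evalRingHom] at nextCoeff_eq
  rw [natDegree_map_of_leadingCoeff_ne_zero _ hx] at natDegree_ne_zero
  refine ⟨natDegree_ne_zero, ?_⟩
  rw [eval_neg, eval_mul, eval_C, nextCoeff_eq]
  field_simp

/- Over almost every `x` the unique point is the only root, with some multiplicity, of a member `G`
of `I` of minimal degree; the two leading coefficients of `G` then give it as a rational function
of `x`, because the multiplicity is invertible. -/
theorem exists_isCoprime_section [CharZero K] {I : Ideal K[X][Y]}
    (h : ∀ᶠ x in cofinite, ∃! y, ∀ F ∈ I, F.evalEval x y = 0) :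
    ∃ N D : K[X], IsCoprime N D ∧ ∀ᶠ x in cofinite,
      D.eval x ≠ 0 ∧ ∀ F ∈ I, F.evalEval x (N.eval x / D.eval x) = 0 := by
  have hI : I ≠ ⊥ := by
    rintro rfl
    obtain ⟨x, y, -, y_unique⟩ := h.exists
    exact zero_ne_one ((y_unique 0 (by simp)).trans (y_unique 1 (by simp)).symm)
  obtain ⟨G, hG, hG₀, dvd_of_mem⟩ := exists_mem_forall_dvd_leadingCoeff_pow_mul hI
  have hlc : G.leadingCoeff ≠ 0 := leadingCoeff_ne_zero.mpr hG₀
  have section_eq : ∀ᶠ x in cofinite, G.natDegree ≠ 0 ∧ ∀ F ∈ I, F.evalEval x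
      ((-G.nextCoeff).eval x / (C (G.natDegree : K) * G.leadingCoeff).eval x) = 0 := by
    filter_upwards [h, eventually_eval_ne_zero hlc] with x ⟨y, hy, y_unique⟩ hx
    have unique_root (z : K) : G.evalEval x z = 0 ↔ z = y := by
      refine ⟨fun hz => y_unique z fun F hF => ?_, fun hz => hz ▸ hy G hG⟩
      obtain ⟨k, hk⟩ := dvd_of_mem F hF
      have := zero_dvd_iff.mp (hz ▸ evalEval_dvd x z hk)
      rw [evalEval_mul, evalEval_C, eval_pow] at this
      exact (mul_eq_zero.mp this).resolve_left (pow_ne_zero k hx)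
    obtain ⟨natDegree_ne_zero, y_eq⟩ := eq_div_of_unique_root_evalEval hx unique_root
    exact ⟨natDegree_ne_zero, y_eq ▸ hy⟩
  obtain ⟨-, natDegree_ne_zero, -⟩ := section_eq.exists
  obtain ⟨N, D, hND, fraction_eq⟩ := exists_isCoprime_eventually_div_eq (-G.nextCoeff)
    (mul_ne_zero (C_ne_zero.mpr (Nat.cast_ne_zero.mpr natDegree_ne_zero)) hlc)
  refine ⟨N, D, hND, ?_⟩
  filter_upwards [section_eq, fraction_eq] with x ⟨_, hx⟩ ⟨hD, hx_eq⟩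
  exact ⟨hD, hx_eq ▸ hx⟩

end RationalSections

section Proportional

open Polynomial

theorem exists_unit_mul_of_proportional {R ι : Type*} [CommSemiring R] {u v : ι → R}
    (hu : Ideal.span (Set.range u) = ⊤) (hv : Ideal.span (Set.range v) = ⊤)
    (huv : ∀ i j, u i * v j = u j * v i) : ∃ c : Rˣ, ∀ i, v i = c * u i := by
  have multiplier (r : R) (hr : r ∈ Ideal.span (Set.range u)) : ∃ w, ∀ j, r * v j = w * u j := by
    induction hr using Submodule.span_induction with
    | mem r hr =>
      obtain ⟨i, rfl⟩ := hr
      exact ⟨v i, fun j => by rw [huv, mul_comm]⟩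
    | zero => exact ⟨0, fun j => by rw [zero_mul, zero_mul]⟩
    | add r s _ _ hr hs =>
      obtain ⟨a, ha⟩ := hr
      obtain ⟨b, hb⟩ := hs
      exact ⟨a + b, fun j => by rw [add_mul, add_mul, ha, hb]⟩
    | smul a r _ hr =>
      obtain ⟨b, hb⟩ := hr
      exact ⟨a * b, fun j => by rw [smul_eq_mul, mul_assoc, mul_assoc, hb]⟩
  obtain ⟨w, hw⟩ := multiplier 1 (hu ▸ Submodule.mem_top)
  simp only [one_mul] at hw
  have w_isUnit : IsUnit w := by
    rw [← Ideal.span_singleton_eq_top, eq_top_iff, ← hv, Ideal.span_le, Set.range_subset_iff]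
    exact fun j => Ideal.mem_span_singleton.mpr ⟨u j, hw j⟩
  exact ⟨w_isUnit.unit, hw⟩

variable {K ι : Type*} [Field K] [IsAlgClosed K] {u v : ι → K[X]}

theorem span_range_eq_top_of_forall_exists_eval_ne_zero (hu : ∀ x, ∃ i, (u i).eval x ≠ 0) :
    Ideal.span (Set.range u) = ⊤ := by
  obtain ⟨g, hg⟩ := IsPrincipalIdealRing.principal (Ideal.span (Set.range u))
  rw [Ideal.submodule_span_eq] at hg
  rw [hg, Ideal.span_singleton_eq_top, isUnit_iff_degree_eq_zero]
  by_contra degree_ne_zero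
  obtain ⟨x, hx⟩ := IsAlgClosed.exists_root g degree_ne_zero
  obtain ⟨i, hi⟩ := hu x
  have g_dvd : g ∣ u i :=
    Ideal.mem_span_singleton.mp (hg ▸ Ideal.subset_span (Set.mem_range_self i))
  exact hi (eval_eq_zero_of_dvd_of_eval_eq_zero g_dvd hx)

theorem exists_C_mul_of_proportional (hu : ∀ x, ∃ i, (u i).eval x ≠ 0)
    (hv : ∀ x, ∃ i, (v i).eval x ≠ 0) (huv : ∀ i j, u i * v j = u j * v i) :
    ∃ c : K, c ≠ 0 ∧ ∀ i, v i = C c * u i := by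
  obtain ⟨w, hw⟩ := exists_unit_mul_of_proportional
    (span_range_eq_top_of_forall_exists_eval_ne_zero hu)
    (span_range_eq_top_of_forall_exists_eval_ne_zero hv) huv
  obtain ⟨c, hc, hcw⟩ := isUnit_iff.mp w.isUnit
  exact ⟨c, hc.ne_zero, fun i => by rw [hw, hcw]⟩

end Proportional

section BinaryForms

open Polynomial

variable {R : Type*} [CommSemiring R]

theorem coeff_aeval_of_natDegree_le {σ : Type*} {f : σ → R[X]} {e : ℕ}
    (hf : ∀ i, (f i).natDegree ≤ e) {F : MvPolynomial σ R} {d : ℕ} (hF : F.IsHomogeneous d) :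
    (MvPolynomial.aeval f F).coeff (d * e) = MvPolynomial.eval (fun i => (f i).coeff e) F := by
  rw [MvPolynomial.aeval_def, MvPolynomial.eval₂_eq, MvPolynomial.eval_eq, finsetSum_coeff]
  refine Finset.sum_congr rfl fun m hm => ?_
  have card_eq : (m.toMultiset.map f).card = d := by
    rw [Multiset.card_map, Finsupp.card_toMultiset]
    exact (DFunLike.congr_fun Finsupp.degree_eq_weight_one m).trans
      (hF (MvPolynomial.mem_support_iff.mp hm))
  have prod_eq {S : Type _} [CommSemiring S] (g : σ → S) :
      ∏ i ∈ m.support, g i ^ m i = (m.toMultiset.map g).prod := by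
    classical
    rw [Finset.prod_multiset_map_count, Finsupp.toFinset_toMultiset]
    simp only [Finsupp.count_toMultiset]
  rw [algebraMap_eq, coeff_C_mul, prod_eq, prod_eq, ← card_eq,
    coeff_multiset_prod_of_natDegree_le, Multiset.map_map]
  · rfl
  · simpa using fun i _ => hf i

theorem exists_natDegree_le_and_coeff_ne_zero {ι : Type*} [Finite ι] {f : ι → R[X]} (hf : f ≠ 0) :
    ∃ e, (∀ i, (f i).natDegree ≤ e) ∧ (fun i => (f i).coeff e) ≠ 0 := by
  obtain ⟨j, hj⟩ := Function.ne_iff.mp hf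
  have : Nonempty {i // f i ≠ 0} := ⟨⟨j, hj⟩⟩
  obtain ⟨⟨i, hi⟩, i_maximal⟩ := Finite.exists_max fun i : {i // f i ≠ 0} => (f i).natDegree
  refine ⟨(f i).natDegree, fun k => ?_, Function.ne_iff.mpr ⟨i, leadingCoeff_ne_zero.mpr hi⟩⟩
  rcases eq_or_ne (f k) 0 with hk | hk
  · simp [hk]
  · exact i_maximal ⟨k, hk⟩

theorem eval_aeval_pair (N D : R[X]) (F : MvPolynomial (Fin 2) R) (x : R) :
    (MvPolynomial.aeval ![N, D] F).eval x = MvPolynomial.eval ![N.eval x, D.eval x] F := by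
  rw [← coe_evalRingHom, MvPolynomial.map_aeval, MvPolynomial.eval]
  congr 2
  · ext a
    simp
  · funext j
    fin_cases j <;> simp

/-- The dehomogenization `F(x, 1)` of a bivariate polynomial `F(s, t)`. -/
noncomputable def dehom : MvPolynomial (Fin 2) R →ₐ[R] R[X] := MvPolynomial.aeval ![X, 1]

theorem eval_dehom (F : MvPolynomial (Fin 2) R) (x : R) :
    (dehom F).eval x = MvPolynomial.eval ![x, 1] F := by
  rw [dehom, eval_aeval_pair, eval_X, eval_one]

theorem eq_of_dehom_eq {F G : MvPolynomial (Fin 2) R} {d : ℕ} (hF : F.IsHomogeneous d)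
    (hG : G.IsHomogeneous d) (h : dehom F = dehom G) : F = G :=
  (homogenize_eq_of_isHomogeneous hF h).symm.trans (homogenize_eq_of_isHomogeneous hG rfl)

theorem natDegree_dehom_le {F : MvPolynomial (Fin 2) R} {d : ℕ} (hF : F.IsHomogeneous d) :
    (dehom F).natDegree ≤ d := by
  have natDegree_le (i : Fin 2) : (![X, 1] i : R[X]).natDegree ≤ 1 := by
    fin_cases i
    · exact natDegree_X_le
    · exact natDegree_one.trans_le zero_le_one
  rw [dehom, ← mul_one d]
  exact MvPolynomial.aeval_natDegree_le F hF.totalDegree_le _ natDegree_le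

theorem dehom_linSubst {N D : R[X]} (hN : N.natDegree ≤ 1) (hD : D.natDegree ≤ 1)
    (F : MvPolynomial (Fin 2) R) :
    dehom (linSubst !![N.coeff 1, N.coeff 0; D.coeff 1, D.coeff 0] F) =
      MvPolynomial.aeval ![N, D] F := by
  rw [dehom, linSubst, MvPolynomial.aeval_bind₁]
  congr 2
  funext j
  fin_cases j
  · simpa [Matrix.toMvPolynomial, ← MvPolynomial.C_mul_X_eq_monomial] using
      (eq_X_add_C_of_natDegree_le_one hN).symm
  · simpa [Matrix.toMvPolynomial, ← MvPolynomial.C_mul_X_eq_monomial] using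
      (eq_X_add_C_of_natDegree_le_one hD).symm

end BinaryForms

section Fibers

open Filter

theorem eventually_exists_preimage_singleton_eq {α β γ : Type*} {f : α → γ} {g : β → γ}
    (hfg : Set.range f ⊆ Set.range g) {S : Set α} {T E : Set β} (hS : S.Finite)
    (hf : Set.InjOn f Sᶜ) (hT : T.Finite) (hg : Set.InjOn g Tᶜ) (hE : E.Finite) :
    ∀ᶠ x in cofinite, ∃ y ∉ E, g ⁻¹' {f x} = {y} := by
  have exceptional_finite : (S ∪ (Sᶜ ∩ f ⁻¹' (g '' (T ∪ E)))).Finite :=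
    hS.union (Set.Finite.of_finite_image
      (((hT.union hE).image g).subset (Set.image_subset_iff.mpr Set.inter_subset_right))
      (hf.mono Set.inter_subset_left))
  filter_upwards [exceptional_finite.compl_mem_cofinite] with x hx
  have notMem_of_eq {z : β} (hz : g z = f x) : z ∉ T ∪ E := fun hzTE =>
    hx (or_iff_not_imp_left.mpr fun hxS => ⟨hxS, z, hzTE, hz⟩)
  obtain ⟨y, hy⟩ := hfg ⟨x, rfl⟩
  refine ⟨y, fun hyE => notMem_of_eq hy (Or.inr hyE), Set.eq_singleton_iff_unique_mem.mpr
    ⟨hy, fun z hz => hg (fun hzT => ?_) (fun hyT => ?_) (hz.trans hy.symm)⟩⟩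
  · exact notMem_of_eq hz (Or.inl hzT)
  · exact notMem_of_eq hy (Or.inl hyT)

end Fibers

section ProjectiveLine

variable {K : Type*} [Field K]

theorem mk_eq_mk_iff_mul_eq_mul {ι : Type*} {v w : ι → K} (hv : v ≠ 0) (hw : w ≠ 0) :
    Projectivization.mk K v hv = Projectivization.mk K w hw ↔ ∀ i j, v i * w j = v j * w i := by
  rw [Projectivization.mk_eq_mk_iff']
  constructor
  · rintro ⟨a, rfl⟩ i j
    simp only [Pi.smul_apply, smul_eq_mul]
    ring
  · intro h
    obtain ⟨j, hj⟩ := Function.ne_iff.mp hw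
    rw [Pi.zero_apply] at hj
    refine ⟨v j / w j, funext fun i => ?_⟩
    rw [Pi.smul_apply, smul_eq_mul, div_mul_eq_mul_div, div_eq_iff hj, h]

theorem vec_one_ne_zero (x : K) : ![x, 1] ≠ 0 := fun h => one_ne_zero (congrFun h 1)

/-- The point `[x : 1]` of the projective line. -/
def affinePoint (x : K) : ℙ K (Fin 2 → K) :=
  Projectivization.mk K ![x, 1] (vec_one_ne_zero x)

theorem affinePoint_injective : Function.Injective (affinePoint : K → _) := fun x y h => by
  simpa using (mk_eq_mk_iff_mul_eq_mul _ _).mp h 0 1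

theorem mk_eq_affinePoint {v : Fin 2 → K} (hv : v ≠ 0) (hv₁ : v 1 ≠ 0) :
    Projectivization.mk K v hv = affinePoint (v 0 / v 1) := by
  rw [affinePoint, Projectivization.mk_eq_mk_iff']
  refine ⟨v 1, funext fun i => ?_⟩
  fin_cases i <;> simp [mul_div_cancel₀ _ hv₁]

theorem finite_compl_range_affinePoint : (Set.range (affinePoint : K → _))ᶜ.Finite := by
  refine Set.Subsingleton.finite fun x hx y hy => ?_
  induction x using Projectivization.ind with
  | _ v hv =>
  induction y using Projectivization.ind with
  | _ w hw =>
  have hv₁ : v 1 = 0 := of_not_not fun hv₁ => hx ⟨_, (mk_eq_affinePoint hv hv₁).symm⟩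
  have hw₁ : w 1 = 0 := of_not_not fun hw₁ => hy ⟨_, (mk_eq_affinePoint hw hw₁).symm⟩
  rw [mk_eq_mk_iff_mul_eq_mul]
  simp [Fin.forall_fin_two, hv₁, hw₁]

end ProjectiveLine

section Parametrizations

open MvPolynomial Matrix

variable {n d : ℕ}

theorem sum_smul_sum_smul {R ι κ l M : Type*} [Semiring R] [Fintype κ] [Fintype l] [AddCommMonoid M]
    [Module R M] (A : Matrix ι κ R) (B : Matrix κ l R) (f : l → M) (i : ι) :
    ∑ k, A i k • ∑ j, B k j • f j = ∑ j, (A * B) i j • f j := by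
  simp only [Finset.smul_sum, smul_smul, mul_apply, Finset.sum_smul]
  exact Finset.sum_comm

namespace Param

theorem stallForm_eq_det_oscMatrix (p : Param n d) : p.stallForm = (oscMatrix p.form).det :=
  rfl

/-- The composition `A ∘ p` of a parametrization with an invertible linear map of the target. -/
noncomputable def postcomp (A : GL (Fin (n + 1)) ℂ) (p : Param n d) : Param n d where
  form i := ∑ j, A i j • p.form j
  isHomogeneous i := IsHomogeneous.sum _ _ _ fun j _ => by
    rw [smul_eq_C_mul]
    exact (p.isHomogeneous j).C_mul _
  noCommonFactor r hr := p.noCommonFactor r fun i => by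
    have form_eq : p.form i = ∑ k, A⁻¹ i k • ∑ j, A k j • p.form j := by
      rw [sum_smul_sum_smul A⁻¹.val A.val, ← Units.val_mul, inv_mul_cancel]
      simp [one_apply]
    rw [form_eq]
    exact Finset.dvd_sum fun k _ => dvd_smul_of_dvd _ (hr k)

/-- The composition `p ∘ M` of a parametrization with a linear change of coordinates of the
source. -/
noncomputable def precomp (p : Param n d) (M : GL (Fin 2) ℂ) : Param n d where
  form i := linSubst (M : Matrix (Fin 2) (Fin 2) ℂ) (p.form i)
  isHomogeneous i := isHomogeneous_linSubst _ (p.isHomogeneous i)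
  noCommonFactor r hr := by
    have linSubst_inv_dvd (i : Fin (n + 1)) :
        linSubst (M⁻¹ : GL (Fin 2) ℂ).val r ∣ p.form i := by
      have := map_dvd (linSubst (M⁻¹ : GL (Fin 2) ℂ).val) (hr i)
      rwa [linSubst_linSubst, ← Units.val_mul, mul_inv_cancel, Units.val_one,
        linSubst_one] at this
    have := (p.noCommonFactor _ linSubst_inv_dvd).map (linSubst M.val)
    rwa [linSubst_linSubst, ← Units.val_mul, inv_mul_cancel, Units.val_one, linSubst_one] at this

theorem evalAt_postcomp (A : GL (Fin (n + 1)) ℂ) (p : Param n d) (v : Fin 2 → ℂ) :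
    (p.postcomp A).evalAt v = A • p.evalAt v := by
  funext i
  simp only [evalAt, postcomp, map_sum, smul_eval]
  rfl

theorem evalAt_precomp (p : Param n d) (M : GL (Fin 2) ℂ) (v : Fin 2 → ℂ) :
    (p.precomp M).evalAt v = p.evalAt (M • v) := by
  funext i
  simp only [evalAt, precomp, eval_linSubst]
  rfl

theorem toMap_postcomp (A : GL (Fin (n + 1)) ℂ) (p : Param n d) (x : PSpace 1) :
    (p.postcomp A).toMap x = (ProjGenLinGroup.mk A : PGL(Fin (n + 1), ℂ)) • p.toMap x := by
  induction x using Projectivization.ind with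
  | _ v hv => simp only [toMap_mk, Projectivization.PGL.mk_smul_mk, evalAt_postcomp]

theorem toMap_precomp (p : Param n d) (M : GL (Fin 2) ℂ) (x : PSpace 1) :
    (p.precomp M).toMap x = p.toMap ((ProjGenLinGroup.mk M : PGL(Fin 2, ℂ)) • x) := by
  induction x using Projectivization.ind with
  | _ v hv => simp only [toMap_mk, Projectivization.PGL.mk_smul_mk, evalAt_precomp]

theorem eval_dehom_form (p : Param n d) (x : ℂ) (i : Fin (n + 1)) :
    (dehom (p.form i)).eval x = p.evalAt ![x, 1] i :=
  eval_dehom _ _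

theorem exists_eval_dehom_ne_zero (p : Param n d) (x : ℂ) :
    ∃ i, (dehom (p.form i)).eval x ≠ 0 := by
  simp only [eval_dehom_form]
  exact Function.ne_iff.mp (p.evalAt_ne_zero (vec_one_ne_zero x))

theorem toMap_affinePoint_eq_iff {p q : Param n d} {x y : ℂ} :
    p.toMap (affinePoint x) = q.toMap (affinePoint y) ↔ ∀ i j,
      (dehom (p.form i)).eval x * (dehom (q.form j)).eval y =
        (dehom (p.form j)).eval x * (dehom (q.form i)).eval y := by
  rw [affinePoint, affinePoint, toMap_mk, toMap_mk, mk_eq_mk_iff_mul_eq_mul]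
  simp only [eval_dehom_form]

theorem toMap_eq_toMap_iff {p q : Param n d} :
    p.toMap = q.toMap ↔ ∃ c : ℂ, c ≠ 0 ∧ ∀ i, p.form i = c • q.form i := by
  constructor
  · intro h
    have proportional (i j : Fin (n + 1)) :
        dehom (q.form i) * dehom (p.form j) = dehom (q.form j) * dehom (p.form i) :=
      Polynomial.funext fun x => by
        simpa only [Polynomial.eval_mul] using
          toMap_affinePoint_eq_iff.mp (congrFun h (affinePoint x)).symm i j
    obtain ⟨c, hc, hpq⟩ := exists_C_mul_of_proportional q.exists_eval_dehom_ne_zero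
      p.exists_eval_dehom_ne_zero proportional
    refine ⟨c, hc, fun i => eq_of_dehom_eq (p.isHomogeneous i) ?_ ?_⟩
    · rw [smul_eq_C_mul]
      exact (q.isHomogeneous i).C_mul c
    · rw [hpq, map_smul, Polynomial.smul_eq_C_mul]
  · rintro ⟨c, -, hpq⟩
    funext x
    induction x using Projectivization.ind with
    | _ v hv =>
    rw [toMap_mk, toMap_mk, Projectivization.mk_eq_mk_iff']
    refine ⟨c, funext fun i => ?_⟩
    rw [Pi.smul_apply, evalAt, evalAt, hpq, smul_eval, smul_eq_mul]

theorem evalAt_zero (p : Param n d) (hd : d ≠ 0) : p.evalAt 0 = 0 := by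
  rw [← zero_smul ℂ (0 : Fin 2 → ℂ), evalAt_smul, zero_pow hd, zero_smul]

theorem IsBirational.degree_ne_zero {p : Param n d} (hp : p.IsBirational) : d ≠ 0 := by
  rintro rfl
  obtain ⟨S, hS, hpS⟩ := hp
  have evalAt_eq (v : Fin 2 → ℂ) : p.evalAt v = p.evalAt 0 := by
    simpa using (p.evalAt_smul 0 v).symm
  have toMap_eq (x y : ℂ) : p.toMap (affinePoint x) = p.toMap (affinePoint y) := by
    simp only [affinePoint, toMap_mk, evalAt_eq]
  obtain ⟨x, hx, y, hy, hxy⟩ := (hS.preimage affinePoint_injective.injOn).infinite_compl.nontrivial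
  exact hxy (affinePoint_injective (hpS hx hy (toMap_eq x y)))

theorem IsBirational.postcomp {p : Param n d} (hp : p.IsBirational) (A : GL (Fin (n + 1)) ℂ) :
    (p.postcomp A).IsBirational := by
  obtain ⟨S, hS, hpS⟩ := hp
  refine ⟨S, hS, fun x hx y hy hxy => hpS hx hy ?_⟩
  rw [toMap_postcomp, toMap_postcomp] at hxy
  exact MulAction.injective _ hxy

end Param

theorem IsRationalCurve.postcomp {C : Set (PSpace n)} {p : Param n d} (hp : IsRationalCurve C p)
    (A : GL (Fin (n + 1)) ℂ) :
    IsRationalCurve ((fun x => (ProjGenLinGroup.mk A : PGL(Fin (n + 1), ℂ)) • x) '' C)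
      (p.postcomp A) where
  isBirational := hp.isBirational.postcomp A
  range_eq := by
    rw [← hp.range_eq, ← Set.range_comp]
    exact congrArg Set.range (funext (p.toMap_postcomp A))

end Parametrizations

section Reparametrization

open Polynomial Filter

open scoped Polynomial.Bivariate

/-- The equations of the correspondence `{(x, y) | u(x) ∼ w(y)}` between two affine lines that map
to the same projective space by the tuples of polynomials `u` and `w`; the bivariate polynomials
have `x` as inner and `y` as outer variable. -/
noncomputable def correspondence {R ι : Type*} [CommRing R] (u w : ι → R[X]) : Ideal R[X][Y] :=
  Ideal.span (Set.range fun ij : ι × ι =>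
    C (u ij.1) * (w ij.2).map C - C (u ij.2) * (w ij.1).map C)

theorem forall_mem_correspondence_evalEval_eq_zero_iff {R ι : Type*} [CommRing R] (u w : ι → R[X])
    (x y : R) :
    (∀ F ∈ correspondence u w, F.evalEval x y = 0) ↔
      ∀ i j, (u i).eval x * (w j).eval y = (u j).eval x * (w i).eval y := by
  change correspondence u w ≤ RingHom.ker (evalEvalRingHom x y) ↔ _
  rw [correspondence, Ideal.span_le, Set.range_subset_iff, Prod.forall]
  simp only [SetLike.mem_coe, RingHom.mem_ker, coe_evalEvalRingHom, evalEval_sub, evalEval_mul,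
    evalEval_C, evalEval_map_C, sub_eq_zero]

variable {n d : ℕ}

namespace Param

theorem natDegree_le_of_natDegree_aeval_le (q : Param n d) (hd : d ≠ 0) {f : Fin 2 → ℂ[X]}
    (hf : f ≠ 0) {m : ℕ} (h : ∀ i, (MvPolynomial.aeval f (q.form i)).natDegree ≤ d * m)
    (j : Fin 2) : (f j).natDegree ≤ m := by
  obtain ⟨e, natDegree_le, coeff_ne_zero⟩ := exists_natDegree_le_and_coeff_ne_zero hf
  obtain ⟨i, hi⟩ := Function.ne_iff.mp (q.evalAt_ne_zero coeff_ne_zero)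
  have hi' : (MvPolynomial.aeval f (q.form i)).coeff (d * e) ≠ 0 := by
    rwa [coeff_aeval_of_natDegree_le natDegree_le (q.isHomogeneous i)]
  exact (natDegree_le j).trans (Nat.le_of_mul_le_mul_left
    ((le_natDegree_of_ne_zero hi').trans (h i)) (Nat.pos_of_ne_zero hd))

theorem det_ne_zero_of_linSubst_eq {p q : Param n d} (hd : d ≠ 0) {M : Matrix (Fin 2) (Fin 2) ℂ}
    {c : ℂ} (hc : c ≠ 0) (h : ∀ i, linSubst M (q.form i) = c • p.form i) : M.det ≠ 0 := by
  intro hM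
  obtain ⟨v, hv, hMv⟩ := Matrix.exists_mulVec_eq_zero_iff.mpr hM
  refine p.evalAt_ne_zero hv (funext fun i => (mul_eq_zero.mp ?_).resolve_left hc)
  calc c * MvPolynomial.eval v (p.form i)
    _ = MvPolynomial.eval v (linSubst M (q.form i)) := by rw [h, MvPolynomial.smul_eval]
    _ = q.evalAt 0 i := by rw [eval_linSubst, hMv, evalAt]
    _ = 0 := congrFun (q.evalAt_zero hd) i

theorem forall_mem_correspondence_dehom_iff {p q : Param n d} {x y : ℂ} :
    (∀ F ∈ correspondence (fun i => dehom (p.form i)) (fun i => dehom (q.form i)),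
      F.evalEval x y = 0) ↔ p.toMap (affinePoint x) = q.toMap (affinePoint y) :=
  (forall_mem_correspondence_evalEval_eq_zero_iff _ _ x y).trans toMap_affinePoint_eq_iff.symm

theorem eventually_existsUnique_toMap_affinePoint_eq {p q : Param n d} (hp : p.IsBirational)
    (hq : q.IsBirational) (hpq : Set.range p.toMap ⊆ Set.range q.toMap) :
    ∀ᶠ x in cofinite, ∃! y, p.toMap (affinePoint x) = q.toMap (affinePoint y) := by
  obtain ⟨S, hS, hpS⟩ := hp
  obtain ⟨T, hT, hqT⟩ := hq
  have fiber_eq := eventually_exists_preimage_singleton_eq hpq hS hpS hT hqT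
    finite_compl_range_affinePoint
  filter_upwards [affinePoint_injective.tendsto_cofinite.eventually fiber_eq] with x ⟨z, hz, hxz⟩
  obtain ⟨y, rfl⟩ := not_not.mp hz
  rw [Set.eq_singleton_iff_unique_mem] at hxz
  exact ⟨y, hxz.1.symm, fun y' hy' => affinePoint_injective (hxz.2 _ hy'.symm)⟩

theorem exists_isCoprime_aeval_eq {p q : Param n d} (hp : p.IsBirational) (hq : q.IsBirational)
    (hpq : Set.range p.toMap ⊆ Set.range q.toMap) :
    ∃ (N D : ℂ[X]) (c : ℂ), IsCoprime N D ∧ c ≠ 0 ∧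
      ∀ i, MvPolynomial.aeval ![N, D] (q.form i) = C c * dehom (p.form i) := by
  have unique_solution := eventually_existsUnique_toMap_affinePoint_eq hp hq hpq
  simp only [← forall_mem_correspondence_dehom_iff] at unique_solution
  obtain ⟨N, D, hND, solution⟩ := exists_isCoprime_section unique_solution
  simp only [forall_mem_correspondence_dehom_iff] at solution
  have eval_ne_zero (x : ℂ) : ![N.eval x, D.eval x] ≠ 0 := fun h =>
    (aeval_ne_zero_of_isCoprime hND x).elim (· (congrFun h 0)) (· (congrFun h 1))
  have proportional (i j : Fin (n + 1)) :
      dehom (p.form i) * MvPolynomial.aeval ![N, D] (q.form j) =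
        dehom (p.form j) * MvPolynomial.aeval ![N, D] (q.form i) := by
    refine eq_of_eventually_eval_eq ?_
    filter_upwards [solution] with x ⟨hDx, hx⟩
    have quotient_eq : Projectivization.mk ℂ _ (eval_ne_zero x) =
        affinePoint (N.eval x / D.eval x) := mk_eq_affinePoint _ hDx
    rw [← quotient_eq, affinePoint, toMap_mk, toMap_mk, mk_eq_mk_iff_mul_eq_mul] at hx
    simp only [eval_mul, eval_dehom_form, eval_aeval_pair]
    exact hx i j
  obtain ⟨c, hc, hqp⟩ := exists_C_mul_of_proportional p.exists_eval_dehom_ne_zero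
    (fun x => by
      simp only [eval_aeval_pair]
      exact Function.ne_iff.mp (q.evalAt_ne_zero (eval_ne_zero x))) proportional
  exact ⟨N, D, c, hND, hc, hqp⟩

theorem exists_toMap_precomp_eq {p q : Param n d} (hp : p.IsBirational) (hq : q.IsBirational)
    (hpq : Set.range p.toMap ⊆ Set.range q.toMap) :
    ∃ M : GL (Fin 2) ℂ, (q.precomp M).toMap = p.toMap := by
  obtain ⟨N, D, c, hND, hc, hqp⟩ := exists_isCoprime_aeval_eq hp hq hpq
  obtain ⟨hN, hD⟩ : N.natDegree ≤ 1 ∧ D.natDegree ≤ 1 :=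
    Fin.forall_fin_two.mp <| q.natDegree_le_of_natDegree_aeval_le hp.degree_ne_zero
      (fun h => hND.ne_zero_or_ne_zero.elim (· (congrFun h 0)) (· (congrFun h 1))) fun i => by
        rw [hqp, mul_one]
        exact (natDegree_C_mul_le _ _).trans (natDegree_dehom_le (p.isHomogeneous i))
  set M := !![N.coeff 1, N.coeff 0; D.coeff 1, D.coeff 0]
  have linSubst_eq (i : Fin (n + 1)) : linSubst M (q.form i) = c • p.form i := by
    refine eq_of_dehom_eq (isHomogeneous_linSubst _ (q.isHomogeneous i)) ?_ ?_
    · rw [MvPolynomial.smul_eq_C_mul]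
      exact (p.isHomogeneous i).C_mul c
    · rw [dehom_linSubst hN hD, hqp, map_smul, smul_eq_C_mul]
  have hM := det_ne_zero_of_linSubst_eq hp.degree_ne_zero hc linSubst_eq
  exact ⟨Matrix.GeneralLinearGroup.mkOfDetNeZero M hM,
    toMap_eq_toMap_iff.mpr ⟨c, hc, linSubst_eq⟩⟩

end Param

end Reparametrization

section InducedAutomorphism

open Matrix

variable {n d : ℕ}

theorem mk_mem_formEquivs {p q : Param n d} {A : GL (Fin (n + 1)) ℂ} {M : GL (Fin 2) ℂ}
    (h : (q.precomp M).toMap = (p.postcomp A).toMap) :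
    ProjGenLinGroup.mk M ∈ formEquivs p.stallForm q.stallForm := by
  obtain ⟨c, hc, hqp⟩ := Param.toMap_eq_toMap_iff.mp h
  set a := M.val.det ^ (n + 1).choose 2
  set b := (c • A.val).det with hb
  have ha : a ≠ 0 := pow_ne_zero _ (M.isUnit.map detMonoidHom).ne_zero
  have b_ne_zero : b ≠ 0 := by
    rw [hb, det_smul]
    exact mul_ne_zero (pow_ne_zero _ hc) (A.isUnit.map detMonoidHom).ne_zero
  have linSubst_eq :
      (fun i => linSubst M.val (q.form i)) = fun i => ∑ j, (c • A.val) i j • p.form j := by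
    funext i
    simp only [Matrix.smul_apply, smul_assoc, ← Finset.smul_sum]
    exact hqp i
  refine ⟨M, rfl, a⁻¹ * b, mul_ne_zero (inv_ne_zero ha) b_ne_zero, ?_⟩
  rw [substForm_eq_linSubst, mul_smul, eq_inv_smul_iff₀ ha, Param.stallForm_eq_det_oscMatrix,
    Param.stallForm_eq_det_oscMatrix, ← det_oscMatrix_linSubst, linSubst_eq,
    det_oscMatrix_linearCombination]

theorem exists_mem_formEquivs_toMap_smul_eq {C D : Set (PSpace n)} {p q : Param n d}
    (hp : IsRationalCurve C p) (hq : IsRationalCurve D q) {φ : PGL(Fin (n + 1), ℂ)}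
    (hφ : φ ∈ equivs C D) :
    ∃ ψ ∈ formEquivs p.stallForm q.stallForm, ∀ x, q.toMap (ψ • x) = φ • p.toMap x := by
  obtain ⟨A, rfl⟩ := ProjGenLinGroup.mk_surjective φ
  have hpA : IsRationalCurve D (p.postcomp A) := hφ ▸ hp.postcomp A
  obtain ⟨M, hM⟩ := Param.exists_toMap_precomp_eq hpA.isBirational hq.isBirational
    (hpA.range_eq.trans hq.range_eq.symm).le
  refine ⟨ProjGenLinGroup.mk M, mk_mem_formEquivs hM, fun x => ?_⟩
  rw [← Param.toMap_precomp, ← Param.toMap_postcomp, hM]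

theorem IsInvComp.of_forall_toMap_smul_eq {p q : Param n d} {φ : PGL(Fin (n + 1), ℂ)}
    {ψ : PGL(Fin 2, ℂ)} (hp : p.IsBirational) (hq : q.IsBirational)
    (h : ∀ x, q.toMap (ψ • x) = φ • p.toMap x) : IsInvComp q φ p ψ := by
  obtain ⟨S, hS, hpS⟩ := hp
  obtain ⟨T, hT, hqT⟩ := hq
  have range_subset : (Set.range fun x => φ • p.toMap x) ⊆ Set.range q.toMap :=
    Set.range_subset_iff.mpr fun x => ⟨ψ • x, h x⟩
  filter_upwards [eventually_exists_preimage_singleton_eq range_subset hS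
    ((MulAction.injective φ).comp_injOn hpS) hT hqT Set.finite_empty] with x ⟨y, _, hxy⟩
  have : ψ • x ∈ q.toMap ⁻¹' {φ • p.toMap x} := h x
  rw [hxy, Set.mem_singleton_iff] at this
  rw [hxy, this]

end InducedAutomorphism

section Uniqueness

variable {n d : ℕ}

theorem mk_mem_hyperplane_iff {a v : Fin (n + 1) → ℂ} (hv : v ≠ 0) :
    Projectivization.mk ℂ v hv ∈ hyperplane a ↔ ∑ i, a i * v i = 0 := by
  obtain ⟨r, hr⟩ := Projectivization.exists_smul_eq_mk_rep ℂ v hv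
  simp only [hyperplane, Set.mem_ofPred_eq, ← hr, Units.smul_def, Pi.smul_apply, smul_eq_mul,
    mul_left_comm _ (r : ℂ), ← Finset.mul_sum, mul_eq_zero, r.ne_zero, false_or]

theorem Nondegenerate.linearIndependent_form {p : Param n d}
    (hp : Nondegenerate (Set.range p.toMap)) : LinearIndependent ℂ p.form := by
  rw [Fintype.linearIndependent_iff]
  intro a ha
  refine congrFun (of_not_not fun a_ne_zero => hp a a_ne_zero ?_)
  rintro _ ⟨x, rfl⟩
  induction x using Projectivization.ind with
  | _ v hv =>
  rw [Param.toMap_mk, mk_mem_hyperplane_iff]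
  simpa [Param.evalAt] using congrArg (MvPolynomial.eval v) ha

theorem eq_of_forall_smul_toMap_eq {p : Param n d} (hp : LinearIndependent ℂ p.form)
    {φ φ' : PGL(Fin (n + 1), ℂ)} (h : ∀ x, φ • p.toMap x = φ' • p.toMap x) : φ = φ' := by
  obtain ⟨A, rfl⟩ := Matrix.ProjGenLinGroup.mk_surjective φ
  obtain ⟨B, rfl⟩ := Matrix.ProjGenLinGroup.mk_surjective φ'
  simp only [← Param.toMap_postcomp] at h
  obtain ⟨c, hc, hAB⟩ := Param.toMap_eq_toMap_iff.mp (funext h)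
  have row_eq (i : Fin (n + 1)) : A i = c • B i := by
    refine hp.fintypeLinearCombination_injective ?_
    rw [map_smul, Fintype.linearCombination_apply, Fintype.linearCombination_apply]
    exact hAB i
  rw [Matrix.ProjGenLinGroup.mk_eq_mk_iff]
  refine ⟨Units.mk0 c⁻¹ (inv_ne_zero hc), Units.ext (Matrix.ext fun i j => ?_)⟩
  simp [row_eq, hc, mul_comm]

end Uniqueness

end RatCurve

theorem mainTheorem1_general (n d : ℕ)
    (C D : Set (RatCurve.PSpace n)) (p q : RatCurve.Param n d)
    (hp : RatCurve.IsRationalCurve C p) (hq : RatCurve.IsRationalCurve D q)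
    (hC : RatCurve.Nondegenerate C) :
    ∃ ι : RatCurve.equivs C D → RatCurve.formEquivs p.stallForm q.stallForm,
      Function.Injective ι ∧
      ∀ φ : RatCurve.equivs C D,
        RatCurve.IsInvComp q (φ : PGL(Fin (n + 1), ℂ)) p (ι φ : PGL(Fin 2, ℂ)) ∧
        ∀ x : RatCurve.PSpace 1,
          q.toMap ((ι φ : PGL(Fin 2, ℂ)) • x) = (φ : PGL(Fin (n + 1), ℂ)) • p.toMap x := by
  choose ψ ψ_mem toMap_smul using fun φ : RatCurve.equivs C D =>
    RatCurve.exists_mem_formEquivs_toMap_smul_eq hp hq φ.2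
  refine ⟨fun φ => ⟨ψ φ, ψ_mem φ⟩, fun φ φ' h => Subtype.ext ?_, fun φ =>
    ⟨.of_forall_toMap_smul_eq hp.isBirational hq.isBirational (toMap_smul φ), toMap_smul φ⟩⟩
  have hψ : ψ φ = ψ φ' := congrArg Subtype.val h
  have form_independent := (hp.range_eq.symm ▸ hC).linearIndependent_form
  exact RatCurve.eq_of_forall_smul_toMap_eq form_independent fun x => by
    rw [← toMap_smul, ← toMap_smul, hψ]

theorem mainTheorem1 (n d : ℕ) (hd : n < d)
    (C D : Set (RatCurve.PSpace n)) (p q : RatCurve.Param n d)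
    (hp : RatCurve.IsRationalCurve C p) (hq : RatCurve.IsRationalCurve D q)
    (hC : RatCurve.Nondegenerate C) (hD : RatCurve.Nondegenerate D) :
    ∃ ι : RatCurve.equivs C D → RatCurve.formEquivs p.stallForm q.stallForm,
      Function.Injective ι ∧
      ∀ φ : RatCurve.equivs C D,
        RatCurve.IsInvComp q (φ : PGL(Fin (n + 1), ℂ)) p (ι φ : PGL(Fin 2, ℂ)) ∧
        ∀ x : RatCurve.PSpace 1,
          q.toMap ((ι φ : PGL(Fin 2, ℂ)) • x) = (φ : PGL(Fin (n + 1), ℂ)) • p.toMap x :=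
  mainTheorem1_general n d C D p q hp hq hC
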